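/- For $p,q,\upsilon\in\mathbb C$ with positive real parts and complex parameters $\gamma_1,\dots,\gamma_6$ let $$E_{p,q,\upsilon}^{(\gamma_1;\gamma_2;\gamma_3;\gamma_4;\gamma_5;\gamma_6)}(z,t)=\sum_{l=0}^{\infty}\sum_{m=0}^{\infty}\frac{(-1)^l(\gamma_1)_{2l}(\gamma_2)_{l+m}(\gamma_3)_l\,z^l\,t^{\upsilon m}}{(\gamma_4)_l(\gamma_5)_l(\gamma_6)_l\,\Gamma(p+l)\,\Gamma(q+\upsilon m)\,m!\,l!},$$ where $(a)_n=a(a+1)\cdots(a+n-1)$ and powers are principal values. For $w_1,w_2\in\mathbb C$ and real $a_1,a_2$ define $$\bigl(\mathfrak E_{p,q}^{(\gamma_1;\dots;\gamma_6)}d\bigr)(z,t)=\int_{a_2}^{t}\int_{a_1}^{z}(z-\xi)^{p-1}(t-y)^{q-1}E_{p,q,\upsilon}^{(\gamma_1;\dots;\gamma_6)}\bigl(w_1(z-\xi),w_2(t-y)\bigr)\,d(\xi,y)\,d\xi\,dy .$$ For $\gamma=(\gamma_1,\gamma_2,\gamma_3)\in\mathbb C^3$ write $\mathfrak E_{p,q}^{(\gamma)}$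 for the operator with the special parameter set $\bigl(\gamma_1;\gamma_2;\gamma_3;\tfrac{\gamma_1+1}{2};\gamma_2;\gamma_3\bigr)$. If one of the denominators $(\tfrac{\gamma_1+1}{2})_l,(\gamma_2)_l,(\gamma_3)_l$ vanishes, the corresponding quotient is read after cancellation, that is, $(\gamma_1)_{2l}/(\tfrac{\gamma_1+1}{2})_l=4^l(\gamma_1/2)_l$, $(\gamma_2)_{l+m}/(\gamma_2)_l=(\gamma_2+l)_m$ and $(\gamma_3)_l/(\gamma_3)_l=1$ respectively. **Theorem.** Let $p,q,\upsilon,\sigma,\tau,w_1,w_2,\gamma_1,\gamma_2,\gamma_3\in\mathbb C$ with $p,q,\upsilon,\sigma,\tau,\gamma_1,\gamma_2,\gamma_3$ of positive real part, let $a_1<b_1$ and $a_2<b_2$ be real, and let $d\in L^1\bigl((a_1,b_1)\times(a_2,b_2)\bigr)$ be complex-valued. 1. For all $\mu=(\mu_1,\mu_2,\mu_3)\in\mathbb C^3$ with $\operatorname{Re}\mu_1,\operatorname{Re}\mu_2,\operatorname{Re}\mu_3>0$, the function $\mathfrak E_{\sigma,\tau}^{(\mu)}d$ lies in $L^1\bigl((a_1,b_1)\times(a_2,b_2)\bigr)$,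 and for almost every $(z,t)\in(a_1,b_1)\times(a_2,b_2)$ the double integrals defining $\mathfrak E_{\sigma,\tau}^{(\mu)}d$, $\mathfrak E_{p,q}^{(\gamma)}\mathfrak E_{\sigma,\tau}^{(\mu)}d$ and $\mathfrak E_{p+\sigma,q+\tau}^{(\gamma+\mu)}d$ at $(z,t)$ converge absolutely and $$\bigl(\mathfrak E_{p,q}^{(\gamma)}\mathfrak E_{\sigma,\tau}^{(\mu)}d\bigr)(z,t)=\bigl(\mathfrak E_{p+\sigma,q+\tau}^{(\gamma+\mu)}d\bigr)(z,t).$$ Here $\gamma+\mu=(\gamma_1+\mu_1,\gamma_2+\mu_2,\gamma_3+\mu_3)$, so the operator on the right has the parameter set $\bigl(\gamma_1+\mu_1;\gamma_2+\mu_2;\gamma_3+\mu_3;\tfrac{\gamma_1+\mu_1+1}{2};\gamma_2+\mu_2;\gamma_3+\mu_3\bigr)$. 2. The function $\mathfrak E_{\sigma,\tau}^{(-\gamma)}d$ lies in $L^1\bigl((a_1,b_1)\times(a_2,b_2)\bigr)$, and for almost every $(z,t)\in(a_1,b_1)\times(a_2,b_2)$ all the double integrals involved converge absolutely and $$\bigl(\mathfrak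 E_{p,q}^{(\gamma)}\mathfrak E_{\sigma,\tau}^{(-\gamma)}d\bigr)(z,t)=\frac{1}{\Gamma(p+\sigma)\Gamma(q+\tau)}\int_{a_2}^{t}\int_{a_1}^{z}(z-\xi)^{p+\sigma-1}(t-y)^{q+\tau-1}d(\xi,y)\,d\xi\,dy,$$ the right-hand side being the Riemann–Liouville double fractional integral $\bigl({}_t\mathbb I_{a_2^+}^{q+\tau}\,{}_z\mathbb I_{a_1^+}^{p+\sigma}d\bigr)(z,t)$. -/

import Mathlib

open MeasureTheory Set

noncomputable section

namespace KonhauserML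

/-- Pochhammer symbol `(a)_n = a (a + 1) ⋯ (a + n - 1)`. -/
def poch (a : ℂ) (n : ℕ) : ℂ := (ascPochhammer ℂ n).eval a

/-- The six upper parameters of the Mittag-Leffler function. -/
structure Params where
  g1 : ℂ
  g2 : ℂ
  g3 : ℂ
  g4 : ℂ
  g5 : ℂ
  g6 : ℂ

/-- The quotient `(γ₁)_{2l} / (γ₄)_l`. Only if the denominator vanishes and `γ₄ = (γ₁ + 1) / 2`,
it is read after cancelling `(γ₄)_l` in `(γ₁)_{2l} = 4^l (γ₁ / 2)_l ((γ₁ + 1) / 2)_l`. -/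
def quot14 (P : Params) (l : ℕ) : ℂ :=
  open Classical in
  if poch P.g4 l = 0 ∧ P.g4 = (P.g1 + 1) / 2 then 4 ^ l * poch (P.g1 / 2) l
  else poch P.g1 (2 * l) / poch P.g4 l

/-- The quotient `(γ₂)_{l+m} / (γ₅)_l`. Only if the denominator vanishes and `γ₅ = γ₂`,
it is read after cancelling `(γ₂)_l` in `(γ₂)_{l+m} = (γ₂)_l (γ₂ + l)_m`. -/
def quot25 (P : Params) (l m : ℕ) : ℂ :=
  open Classical in
  if poch P.g5 l = 0 ∧ P.g5 = P.g2 then poch (P.g2 + l) m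
  else poch P.g2 (l + m) / poch P.g5 l

/-- The quotient `(γ₃)_l / (γ₆)_l`. Only if the denominator vanishes and `γ₆ = γ₃`,
it is read as `1`. -/
def quot36 (P : Params) (l : ℕ) : ℂ :=
  open Classical in
  if poch P.g6 l = 0 ∧ P.g6 = P.g3 then 1
  else poch P.g3 l / poch P.g6 l

/-- The `(l, m)` term
`(-1)^l (γ₁)_{2l} (γ₂)_{l+m} (γ₃)_l z^l t^{υm} /
  ((γ₄)_l (γ₅)_l (γ₆)_l Γ(p + l) Γ(q + υm) m! l!)`. -/
def mlTerm (p q υ : ℂ) (P : Params) (z t : ℂ) (l m : ℕ) : ℂ :=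
  (-1) ^ l * quot14 P l * quot25 P l m * quot36 P l * z ^ l * t ^ (υ * (m : ℂ)) /
    (Complex.Gamma (p + l) * Complex.Gamma (q + υ * m) * (m.factorial : ℂ) * (l.factorial : ℂ))

/-- When no denominator vanishes the term is the plain quotient. -/
theorem mlTerm_eq (p q υ : ℂ) (P : Params) (z t : ℂ) (l m : ℕ)
    (h4 : poch P.g4 l ≠ 0) (h5 : poch P.g5 l ≠ 0) (h6 : poch P.g6 l ≠ 0) :
    mlTerm p q υ P z t l m =
      (-1) ^ l * poch P.g1 (2 * l) * poch P.g2 (l + m) * poch P.g3 l * z ^ l *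
          t ^ (υ * (m : ℂ)) /
        (poch P.g4 l * poch P.g5 l * poch P.g6 l * Complex.Gamma (p + l) *
          Complex.Gamma (q + υ * m) * (m.factorial : ℂ) * (l.factorial : ℂ)) := by
  simp only [mlTerm, quot14, quot25, quot36, h4, h5, h6, false_and, if_false, div_eq_mul_inv,
    mul_inv]
  ring

/-- The modified bivariate I-Konhauser Mittag-Leffler function
`E_{p,q,υ}^{(γ₁;γ₂;γ₃;γ₄;γ₅;γ₆)}(z, t)`. -/
def mittagLeffler (p q υ : ℂ) (P : Params) (z t : ℂ) : ℂ :=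
  ∑' l : ℕ, ∑' m : ℕ, mlTerm p q υ P z t l m

/-- The integrand, at `x = (ξ, y)`, of the integral operator below at the point `X = (z, t)`. -/
def opIntegrand (p q υ w1 w2 : ℂ) (P : Params) (d : ℝ × ℝ → ℂ) (X x : ℝ × ℝ) : ℂ :=
  ((X.1 - x.1 : ℝ) : ℂ) ^ (p - 1) * ((X.2 - x.2 : ℝ) : ℂ) ^ (q - 1) *
    mittagLeffler p q υ P (w1 * ((X.1 - x.1 : ℝ) : ℂ)) (w2 * ((X.2 - x.2 : ℝ) : ℂ)) * d x

/-- The integral operator `𝔈_{p,q,υ;w₁,w₂;a₁⁺,a₂⁺}^{(γ₁;γ₂;γ₃;γ₄;γ₅;γ₆)}`: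
`(𝔈 d)(z, t) = ∫_{a₂}^t ∫_{a₁}^z (z - ξ)^{p-1} (t - y)^{q-1}
  E_{p,q,υ}(w₁ (z - ξ), w₂ (t - y)) d(ξ, y) dξ dy`. -/
def frakE (p q υ w1 w2 : ℂ) (a1 a2 : ℝ) (P : Params) (d : ℝ × ℝ → ℂ) (X : ℝ × ℝ) : ℂ :=
  ∫ y in a2..X.2, ∫ ξ in a1..X.1, opIntegrand p q υ w1 w2 P d X (ξ, y)

/-- The double integral defining `(𝔈 d)(z, t)`, `X = (z, t)`, converges absolutely. -/
def FrakEConverges (p q υ w1 w2 : ℂ) (a1 a2 : ℝ) (P : Params) (d : ℝ × ℝ → ℂ)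
    (X : ℝ × ℝ) : Prop :=
  IntegrableOn (opIntegrand p q υ w1 w2 P d X) (Ioo a1 X.1 ×ˢ Ioo a2 X.2)

/-- The integrand of the Riemann-Liouville double fractional integral at `X = (z, t)`. -/
def rlIntegrand (σ τ : ℂ) (d : ℝ × ℝ → ℂ) (X x : ℝ × ℝ) : ℂ :=
  ((X.1 - x.1 : ℝ) : ℂ) ^ (σ - 1) * ((X.2 - x.2 : ℝ) : ℂ) ^ (τ - 1) * d x

/-- The Riemann-Liouville double fractional integral, of order `σ` in `z` and `τ` in `t`. -/
def rlDouble (σ τ : ℂ) (a1 a2 : ℝ) (d : ℝ × ℝ → ℂ) (X : ℝ × ℝ) : ℂ :=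
  1 / (Complex.Gamma σ * Complex.Gamma τ) *
    ∫ y in a2..X.2, ∫ ξ in a1..X.1, rlIntegrand σ τ d X (ξ, y)

/-- The double integral defining the Riemann-Liouville integral converges absolutely. -/
def RLDoubleConverges (σ τ : ℂ) (a1 a2 : ℝ) (d : ℝ × ℝ → ℂ) (X : ℝ × ℝ) : Prop :=
  IntegrableOn (rlIntegrand σ τ d X) (Ioo a1 X.1 ×ˢ Ioo a2 X.2)

/-- The special parameter set `(γ₁; γ₂; γ₃; (γ₁ + 1) / 2; γ₂; γ₃)`. -/
def special (γ1 γ2 γ3 : ℂ) : Params := ⟨γ1, γ2, γ3, (γ1 + 1) / 2, γ2, γ3⟩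

end KonhauserML

end

open MeasureTheory Set

noncomputable section

namespace KonhauserML

/-! For a special parameter set the quotients cancel: `γ₃` drops out, and what remains are the
Taylor coefficients `coef` of `(1 + 4x/(1-y))^(-γ₁/2) (1-y)^(-γ₂)`. This function is multiplicative
in `(γ₁, γ₂)`, so adding parameters means taking the Cauchy product of the coefficients
(`sum_antidiagonal_coef_mul_coef`).

The kernel is the series obtained by replacing monomials with normalised powers `x^(s-1)/Γ(s)`, and
by the Beta integral these form a convolution semigroup. Hence the kernels for `γ` and `μ` convolve
to the kernel for `γ + μ` (`setIntegral_kernel_mul_kernel`). Termwise integration is justified by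
the superexponential decay of `1/Γ`.

The operators are convolutions with truncated `L¹` kernels, so a.e. associativity of convolution
transfers the identity to them (`ae_volterraOp_volterraOp`). For `μ = -γ` only the coefficient at
`(0, 0)` survives, and the kernel is the Riemann-Liouville one. -/

/-! ### Rising factorials -/

theorem poch_succ (a : ℂ) (n : ℕ) : poch a (n + 1) = poch a n * (a + n) :=
  ascPochhammer_succ_eval n a

open Finset in
/-- Chu-Vandermonde identity for rising factorials. -/
theorem sum_antidiagonal_poch_div_factorial (a b : ℂ) (n : ℕ) :
    ∑ ij ∈ antidiagonal n,
      poch a ij.1 / (ij.1.factorial : ℂ) * (poch b ij.2 / (ij.2.factorial : ℂ)) =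
    poch (a + b) n / (n.factorial : ℂ) := by
  -- Generalised binomial coefficients at `-x` turn the claim into Vandermonde's identity.
  have h (x : ℂ) (k : ℕ) :
      poch x k / (k.factorial : ℂ) = (-1) ^ k * Ring.choose (-x) k := by
    have hk : poch x k = (-1) ^ k * (descPochhammer ℤ k).smeval (-x) := by
      induction k with
      | zero => simp [poch]
      | succ k ih =>
        rw [poch_succ, ih, descPochhammer_succ_right, Polynomial.smeval_mul,
          Polynomial.smeval_sub, Polynomial.smeval_X, Polynomial.smeval_natCast]
        simp only [pow_zero, pow_one, nsmul_eq_mul, mul_one]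
        ring
    rw [Ring.choose_eq_smul, hk, smul_eq_mul, div_eq_inv_mul]
    ring
  simp only [h]
  rw [neg_add, Ring.add_choose_eq n (Commute.all _ _), mul_sum]
  refine sum_congr rfl fun ij hij => ?_
  rw [← mem_antidiagonal.mp hij, pow_add]
  ring

theorem poch_add (a : ℂ) (n m : ℕ) : poch a (n + m) = poch a n * poch (a + n) m := by
  simp [poch, ← ascPochhammer_mul, Polynomial.eval_comp]

theorem poch_two_mul (a : ℂ) (n : ℕ) :
    poch a (2 * n) = 4 ^ n * poch (a / 2) n * poch ((a + 1) / 2) n := by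
  induction n with
  | zero => simp [poch]
  | succ n ih =>
    rw [mul_add, show 2 * n + 2 * 1 = 2 * n + 1 + 1 by ring]
    simp only [poch_succ, ih]
    push_cast
    ring

/-- Factorwise comparison with the rising factorial of `N`, which is `n!` times a binomial
coefficient. -/
theorem norm_poch_le {a : ℂ} {N : ℕ} (ha : ‖a‖ ≤ N) (n : ℕ) :
    ‖poch a n / (n.factorial : ℂ)‖ ≤ 2 ^ (N + n) := by
  have h : ‖poch a n‖ ≤ N.ascFactorial n := by
    induction n with
    | zero => simp [poch]
    | succ n ih =>
      rw [poch_succ, norm_mul, Nat.ascFactorial_succ, mul_comm, Nat.cast_mul, Nat.cast_add]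
      gcongr
      refine (norm_add_le _ _).trans ?_
      simpa using ha
  rw [norm_div, Complex.norm_natCast, div_le_iff₀ (by positivity)]
  refine h.trans ?_
  rw [Nat.ascFactorial_eq_factorial_mul_choose', mul_comm]
  push_cast
  gcongr
  have h1 := Nat.choose_le_two_pow (N + n - 1) n
  have h2 : 2 ^ (N + n - 1) ≤ 2 ^ (N + n) := Nat.pow_le_pow_right (by norm_num) (by omega)
  exact_mod_cast h1.trans h2

/-! ### Decay of the reciprocal Gamma function -/

/-- This is `|B(u, v)| ≤ B(Re u, Re v)`, the triangle inequality for the Beta integral, with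
denominators cleared. -/
theorem norm_Gamma_mul_Gamma_le {u v : ℂ} (hu : 0 < u.re) (hv : 0 < v.re) :
    ‖Complex.Gamma u‖ * ‖Complex.Gamma v‖ * Real.Gamma (u.re + v.re) ≤
      ‖Complex.Gamma (u + v)‖ * (Real.Gamma u.re * Real.Gamma v.re) := by
  have key : Complex.betaIntegral (u.re : ℂ) (v.re : ℂ) =
      ((∫ x in (0 : ℝ)..1, ‖(x : ℂ) ^ (u - 1) * (1 - (x : ℂ)) ^ (v - 1)‖ : ℝ) : ℂ) := by
    rw [Complex.betaIntegral, ← intervalIntegral.integral_ofReal,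
      intervalIntegral.integral_of_le zero_le_one, intervalIntegral.integral_of_le zero_le_one,
      integral_Ioc_eq_integral_Ioo, integral_Ioc_eq_integral_Ioo]
    refine setIntegral_congr_fun measurableSet_Ioo fun x hx => ?_
    have h1 : (1 : ℂ) - x = ((1 - x : ℝ) : ℂ) := by push_cast; ring
    have hx1 : 0 < 1 - x := sub_pos.mpr hx.2
    simp only [h1]
    rw [norm_mul, Complex.norm_cpow_eq_rpow_re_of_pos hx.1,
      Complex.norm_cpow_eq_rpow_re_of_pos hx1]
    push_cast
    rw [Complex.ofReal_cpow hx.1.le, Complex.ofReal_cpow hx1.le]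
    simp
  have h1 := congrArg norm (Complex.Gamma_mul_Gamma_eq_betaIntegral hu hv)
  have h2 := congrArg norm (Complex.Gamma_mul_Gamma_eq_betaIntegral
    (s := (u.re : ℂ)) (t := (v.re : ℂ)) (by simpa) (by simpa))
  have h3 : ‖Complex.betaIntegral u v‖ ≤ ‖Complex.betaIntegral (u.re : ℂ) (v.re : ℂ)‖ := by
    rw [key, Complex.norm_real]
    exact (intervalIntegral.norm_integral_le_integral_norm zero_le_one).trans (le_abs_self _)
  rw [← Complex.ofReal_add] at h2
  simp only [norm_mul, Complex.Gamma_ofReal, Complex.norm_real, Real.norm_eq_abs] at h1 h2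
  rw [abs_of_pos (Real.Gamma_pos_of_pos hu), abs_of_pos (Real.Gamma_pos_of_pos hv),
    abs_of_pos (Real.Gamma_pos_of_pos (add_pos hu hv))] at h2
  rw [h1, h2, mul_assoc, mul_comm ‖Complex.betaIntegral u v‖]
  have := (Real.Gamma_pos_of_pos (add_pos hu hv)).le
  gcongr

/-- Only the part of the Gamma integral over `(T, T + 1]` is kept. As `T` is free, `Γ` outgrows
every exponential. -/
theorem rpow_mul_exp_neg_le_Gamma {T x : ℝ} (hT : 0 < T) (hx : 1 ≤ x) :
    T ^ (x - 1) * Real.exp (-(T + 1)) ≤ Real.Gamma x := by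
  have hi := Real.GammaIntegral_convergent (zero_lt_one.trans_le hx)
  have hsub : Ioc T (T + 1) ⊆ Ioi (0 : ℝ) := fun y hy => hT.trans hy.1
  rw [Real.Gamma_eq_integral (zero_lt_one.trans_le hx)]
  calc T ^ (x - 1) * Real.exp (-(T + 1))
      = ∫ _ in Ioc T (T + 1), T ^ (x - 1) * Real.exp (-(T + 1)) := by simp
    _ ≤ ∫ y in Ioc T (T + 1), Real.exp (-y) * y ^ (x - 1) := by
        refine setIntegral_mono_on (by rw [integrableOn_const_iff]; simp) (hi.mono_set hsub) measurableSet_Ioc fun y hy => ?_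
        rw [mul_comm]
        have := hy.1.le
        have := hy.2
        gcongr
    _ ≤ _ := by
        refine setIntegral_mono_set hi ?_ hsub.eventuallyLE
        filter_upwards [ae_restrict_mem measurableSet_Ioi] with y hy
        have : (0 : ℝ) < y := hy
        positivity

/-- The reciprocal Gamma function decays superexponentially along an arithmetic progression in
the right half plane. -/
theorem summable_pow_div_norm_Gamma {α β : ℂ} (hα : 0 < α.re) (hβ : 0 < β.re) {R : ℝ}
    (hR : 0 ≤ R) : Summable fun n : ℕ => R ^ n / ‖Complex.Gamma (α + β * n)‖ := by
  have hre (n : ℕ) : (α + β * n).re = α.re + β.re * n := by simp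
  have hpos (n : ℕ) : 0 < α.re + β.re * n := by positivity
  have hne {s : ℂ} (hs : 0 < s.re) : 0 < ‖Complex.Gamma s‖ :=
    norm_pos_iff.mpr (Complex.Gamma_ne_zero_of_re_pos hs)
  set K := Real.Gamma β.re / ‖Complex.Gamma β‖ with hK
  have hKpos : 0 < K := div_pos (Real.Gamma_pos_of_pos hβ) (hne hβ)
  set C := Real.Gamma α.re / ‖Complex.Gamma α‖ with hC
  have hCpos : 0 < C := div_pos (Real.Gamma_pos_of_pos hα) (hne hα)
  -- Iterating the Beta inequality in steps of `β` compares real and complex Gamma values at the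
  -- cost of a geometric factor.
  have h1 (n : ℕ) : Real.Gamma (α.re + β.re * n) ≤
      C * K ^ n * ‖Complex.Gamma (α + β * n)‖ := by
    induction n with
    | zero =>
      have := (hne hα).ne'
      simp [hC, this]
    | succ n ih =>
      have h := norm_Gamma_mul_Gamma_le (u := α + β * n) (v := β) (by rw [hre]; exact hpos n) hβ
      rw [hre] at h
      have e1 : α + β * ((n + 1 : ℕ) : ℂ) = α + β * n + β := by push_cast; ring
      have e2 : α.re + β.re * ((n + 1 : ℕ) : ℝ) = α.re + β.re * n + β.re := by push_cast; ring
      rw [e1, e2]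
      have hA : 0 < ‖Complex.Gamma (α + β * n)‖ := hne (by rw [hre]; exact hpos n)
      have hB := hne hβ
      have hG := Real.Gamma_pos_of_pos hβ
      rw [← mul_le_mul_iff_right₀ (mul_pos hA hB)]
      refine h.trans ?_
      calc _ ≤ ‖Complex.Gamma (α + β * n + β)‖ *
            ((C * K ^ n * ‖Complex.Gamma (α + β * n)‖) * Real.Gamma β.re) := by gcongr
        _ = _ := by
          rw [pow_succ, hK]
          field_simp
  -- Chosen so that `T ^ β.re` exceeds `2KR`: this absorbs `K ^ n * R ^ n` and leaves `(1/2) ^ n`.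
  -- The `+ 1` keeps `T` positive when `R = 0`.
  set T := (2 * (K * R) + 1) ^ (1 / β.re) with hT
  have hb : 0 < 2 * (K * R) + 1 := by positivity
  have hTpos : 0 < T := Real.rpow_pos_of_pos hb _
  have hTb : T ^ β.re = 2 * (K * R) + 1 := by
    rw [hT, ← Real.rpow_mul hb.le, one_div_mul_cancel hβ.ne', Real.rpow_one]
  have hlim : ∀ᶠ n : ℕ in Filter.atTop, 1 ≤ α.re + β.re * n := by
    have : Filter.Tendsto (fun n : ℕ => α.re + β.re * n) Filter.atTop Filter.atTop :=
      Filter.tendsto_atTop_add_const_left _ _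
        (tendsto_natCast_atTop_atTop.const_mul_atTop hβ)
    exact this.eventually_ge_atTop 1
  refine Summable.of_norm_bounded_eventually_nat
    (g := fun n => C * (Real.exp (T + 1) * T ^ (1 - α.re)) * (1 / 2) ^ n)
    ((summable_geometric_of_lt_one (by norm_num) (by norm_num)).mul_left _) ?_
  filter_upwards [hlim] with n hn
  have hA : 0 < ‖Complex.Gamma (α + β * n)‖ := hne (by rw [hre]; exact hpos n)
  rw [norm_div, norm_norm, norm_pow, Real.norm_of_nonneg hR, div_le_iff₀ hA]
  have h2 := (rpow_mul_exp_neg_le_Gamma hTpos hn).trans (h1 n)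
  have e3 : T ^ (α.re + β.re * n - 1) = T ^ (α.re - 1) * (2 * (K * R) + 1) ^ n := by
    rw [← hTb, ← Real.rpow_natCast, ← Real.rpow_mul hTpos.le, ← Real.rpow_add hTpos]
    ring_nf
  have e4 : T ^ (1 - α.re) * T ^ (α.re - 1) = 1 := by
    rw [← Real.rpow_add hTpos]; simp
  have e5 : Real.exp (T + 1) * Real.exp (-(T + 1)) = 1 := by rw [← Real.exp_add]; simp
  rw [e3] at h2
  have hKn : 0 < K ^ n := by positivity
  rw [← mul_le_mul_iff_right₀ hKn]
  calc K ^ n * R ^ n = (1 / 2) ^ n * (2 * (K * R)) ^ n := by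
        rw [← mul_pow, ← mul_pow]; ring_nf
    _ ≤ (1 / 2) ^ n * (2 * (K * R) + 1) ^ n := by gcongr; linarith
    _ = (1 / 2) ^ n * ((Real.exp (T + 1) * T ^ (1 - α.re)) *
          (T ^ (α.re - 1) * (2 * (K * R) + 1) ^ n * Real.exp (-(T + 1)))) := by
        linear_combination (-(1 / 2) ^ n * (2 * (K * R) + 1) ^ n) *
          (e5 * (T ^ (1 - α.re) * T ^ (α.re - 1)) + e4)
    _ ≤ (1 / 2) ^ n * ((Real.exp (T + 1) * T ^ (1 - α.re)) *
          (C * K ^ n * ‖Complex.Gamma (α + β * n)‖)) := by gcongr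
    _ = _ := by ring

/-! ### Coefficients for the special parameter sets -/

theorem quot14_special (g1 g2 g3 : ℂ) (l : ℕ) :
    quot14 (special g1 g2 g3) l = 4 ^ l * poch (g1 / 2) l := by
  simp only [quot14, special, and_true]
  split_ifs with h
  · rfl
  · rw [poch_two_mul, mul_div_cancel_right₀ _ h]

theorem quot25_special (g1 g2 g3 : ℂ) (l m : ℕ) :
    quot25 (special g1 g2 g3) l m = poch (g2 + l) m := by
  simp only [quot25, special, and_true]
  split_ifs with h
  · rfl
  · rw [poch_add, mul_div_cancel_left₀ _ h]

theorem quot36_special (g1 g2 g3 : ℂ) (l : ℕ) : quot36 (special g1 g2 g3) l = 1 := by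
  simp only [quot36, special, and_true]
  split_ifs with h
  · rfl
  · exact div_self h

/-- The Taylor coefficients of `(1 + 4 x / (1 - y)) ^ (-g1 / 2) * (1 - y) ^ (-g2)`. -/
def coef (g1 g2 : ℂ) (l m : ℕ) : ℂ :=
  (-4) ^ l * (poch (g1 / 2) l / (l.factorial : ℂ)) * (poch (g2 + l) m / (m.factorial : ℂ))

theorem mlTerm_special (p q υ g1 g2 g3 z t : ℂ) (l m : ℕ) :
    mlTerm p q υ (special g1 g2 g3) z t l m =
      coef g1 g2 l m * z ^ l * t ^ (υ * (m : ℂ)) /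
        (Complex.Gamma (p + l) * Complex.Gamma (q + υ * m)) := by
  simp only [mlTerm, quot14_special, quot25_special, quot36_special, coef, div_eq_mul_inv, mul_inv]
  rw [show (-4 : ℂ) = (-1) * 4 by norm_num, mul_pow]
  ring

open Finset in
-- Chu-Vandermonde is applied twice: in the first index to `g1/2` and `h1/2`, then, for each
-- splitting `L = i + j`, in the second index to `g2 + i` and `h2 + j`.
theorem sum_antidiagonal_coef_mul_coef (g1 g2 h1 h2 : ℂ) (L M : ℕ) :
    ∑ x ∈ antidiagonal L, ∑ y ∈ antidiagonal M, coef g1 g2 x.1 y.1 * coef h1 h2 x.2 y.2 =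
      coef (g1 + h1) (g2 + h2) L M := by
  rw [coef, add_div, ← sum_antidiagonal_poch_div_factorial, mul_sum, sum_mul]
  refine sum_congr rfl fun x hx => ?_
  rw [← mem_antidiagonal.mp hx, Nat.cast_add, add_add_add_comm,
    ← sum_antidiagonal_poch_div_factorial, mul_sum]
  refine sum_congr rfl fun y _ => ?_
  simp only [coef, pow_add]
  ring

/-- The base is `16 = 4 · 2 · 2`: the explicit power of `4`, the first Pochhammer quotient, and the
shift by `l` in the second. -/
theorem exists_norm_coef_le (g1 g2 : ℂ) :
    ∃ C : ℝ, 0 ≤ C ∧ ∀ l m, ‖coef g1 g2 l m‖ ≤ C * 16 ^ l * 2 ^ m := by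
  obtain ⟨N1, h1⟩ := exists_nat_ge ‖g1 / 2‖
  obtain ⟨N2, h2⟩ := exists_nat_ge ‖g2‖
  refine ⟨2 ^ (N1 + N2), by positivity, fun l m => ?_⟩
  have h3 : ‖g2 + l‖ ≤ (N2 + l : ℕ) := by
    refine (norm_add_le _ _).trans ?_
    simpa using h2
  rw [coef, norm_mul, norm_mul, norm_pow]
  calc _ ≤ (4 : ℝ) ^ l * 2 ^ (N1 + l) * 2 ^ (N2 + l + m) := by
        gcongr
        · simp
        · exact norm_poch_le h1 l
        · exact norm_poch_le h3 m
    _ = _ := by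
        rw [show (16 : ℝ) = 4 * 2 * 2 by norm_num]
        simp only [pow_add, mul_pow]
        ring

/-! ### Series expansion of the kernel -/

/-- A positive factor does not change the argument, so the principal logarithm is additive here. -/
theorem mul_ofReal_cpow (w s : ℂ) {y : ℝ} (hy : 0 < y) :
    (w * (y : ℂ)) ^ s = w ^ s * (y : ℂ) ^ s := by
  have hy' : (y : ℂ) ≠ 0 := Complex.ofReal_ne_zero.mpr hy.ne'
  rcases eq_or_ne w 0 with rfl | hw
  · rcases eq_or_ne s 0 with rfl | hs
    · simp
    · simp [Complex.zero_cpow hs]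
  · rw [Complex.cpow_def_of_ne_zero (mul_ne_zero hw hy'), Complex.cpow_def_of_ne_zero hw,
      Complex.cpow_def_of_ne_zero hy', Complex.log_mul_ofReal _ hy _ hw, ← Complex.exp_add,
      Complex.ofReal_log hy.le]
    ring_nf

/-- The convolution kernel of the integral operator. -/
def kernel (p q υ w1 w2 : ℂ) (P : Params) (x : ℝ × ℝ) : ℂ :=
  (x.1 : ℂ) ^ (p - 1) * (x.2 : ℂ) ^ (q - 1) * mittagLeffler p q υ P (w1 * x.1) (w2 * x.2)

/-- The summands of the kernel with the special parameter set. -/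
def kernelTerm (p q υ w1 w2 g1 g2 : ℂ) (i : ℕ × ℕ) (x : ℝ × ℝ) : ℂ :=
  coef g1 g2 i.1 i.2 * w1 ^ i.1 * (w2 ^ υ) ^ i.2 *
    (((x.1 : ℂ) ^ (p + i.1 - 1) / Complex.Gamma (p + i.1)) *
      ((x.2 : ℂ) ^ (q + υ * i.2 - 1) / Complex.Gamma (q + υ * i.2)))

theorem kernelTerm_eq (p q υ w1 w2 g1 g2 g3 : ℂ) (l m : ℕ) {x : ℝ × ℝ} (h1 : 0 < x.1)
    (h2 : 0 < x.2) :
    kernelTerm p q υ w1 w2 g1 g2 (l, m) x =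
      (x.1 : ℂ) ^ (p - 1) * (x.2 : ℂ) ^ (q - 1) *
        mlTerm p q υ (special g1 g2 g3) (w1 * x.1) (w2 * x.2) l m := by
  have h1' : (x.1 : ℂ) ≠ 0 := Complex.ofReal_ne_zero.mpr h1.ne'
  have h2' : (x.2 : ℂ) ≠ 0 := Complex.ofReal_ne_zero.mpr h2.ne'
  rw [mlTerm_special, mul_ofReal_cpow _ _ h2, Complex.cpow_mul_nat w2, mul_pow, kernelTerm,
    show p + ((l, m) : ℕ × ℕ).1 - 1 = (p - 1) + (l : ℂ) by ring,
    show q + υ * ((l, m) : ℕ × ℕ).2 - 1 = (q - 1) + υ * (m : ℂ) by ring,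
    Complex.cpow_add _ _ h1', Complex.cpow_add _ _ h2', Complex.cpow_natCast]
  simp only [div_eq_mul_inv, mul_inv]
  ring

section Bounds

variable {p q υ : ℂ} (w1 w2 g1 g2 g3 : ℂ)

/-- A Weierstrass majorant: on a bounded box the terms share one integrable singularity at the axes,
and the decay of `1/Γ` beats all geometric factors, which are collected in the two choices of `R`.
-/
theorem exists_norm_kernelTerm_le (hp : 0 < p.re) (hq : 0 < q.re) (hυ : 0 < υ.re) (B1 B2 : ℝ) :
    ∃ M : ℕ × ℕ → ℝ, Summable M ∧ (∀ i, 0 ≤ M i) ∧ ∀ i, ∀ x ∈ Ioo 0 B1 ×ˢ Ioo 0 B2,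
      ‖kernelTerm p q υ w1 w2 g1 g2 i x‖ ≤ M i * (x.1 ^ (p.re - 1) * x.2 ^ (q.re - 1)) := by
  obtain ⟨C, hC, hcoef⟩ := exists_norm_coef_le g1 g2
  have s1 := summable_pow_div_norm_Gamma hp (β := 1) (by simp) (R := 16 * ‖w1‖ * |B1|)
    (by positivity)
  have s2 := summable_pow_div_norm_Gamma hq hυ (R := 2 * ‖w2 ^ υ‖ * |B2| ^ υ.re)
    (by positivity)
  simp only [one_mul] at s1
  refine ⟨_, ((s1.mul_of_nonneg s2 (fun _ => by positivity) fun _ => by positivity).mul_left C),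
    fun _ => by positivity, ?_⟩
  rintro ⟨l, m⟩ x ⟨⟨hx1, hx1'⟩, hx2, hx2'⟩
  have e1 : ‖(x.1 : ℂ) ^ (p + l - 1)‖ ≤ x.1 ^ (p.re - 1) * |B1| ^ l := by
    rw [Complex.norm_cpow_eq_rpow_re_of_pos hx1,
      show (p + l - 1).re = (p.re - 1) + (l : ℝ) by simp; ring, Real.rpow_add hx1,
      Real.rpow_natCast]
    gcongr
    exact hx1'.le.trans (le_abs_self _)
  have e2 : ‖(x.2 : ℂ) ^ (q + υ * m - 1)‖ ≤ x.2 ^ (q.re - 1) * (|B2| ^ υ.re) ^ m := by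
    rw [Complex.norm_cpow_eq_rpow_re_of_pos hx2,
      show (q + υ * m - 1).re = (q.re - 1) + υ.re * m by simp; ring, Real.rpow_add hx2,
      Real.rpow_mul hx2.le, Real.rpow_natCast]
    gcongr
    exact hx2'.le.trans (le_abs_self _)
  simp only [kernelTerm, norm_mul, norm_div, norm_pow]
  calc _ ≤ (C * 16 ^ l * 2 ^ m) * ‖w1‖ ^ l * ‖w2 ^ υ‖ ^ m *
        ((x.1 ^ (p.re - 1) * |B1| ^ l) / ‖Complex.Gamma (p + l)‖ *
          ((x.2 ^ (q.re - 1) * (|B2| ^ υ.re) ^ m) / ‖Complex.Gamma (q + υ * m)‖)) := by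
        gcongr
        exact hcoef l m
    _ = _ := by
        simp only [mul_pow]
        ring

theorem summable_norm_kernelTerm (hp : 0 < p.re) (hq : 0 < q.re) (hυ : 0 < υ.re) {x : ℝ × ℝ}
    (h1 : 0 < x.1) (h2 : 0 < x.2) :
    Summable fun i => ‖kernelTerm p q υ w1 w2 g1 g2 i x‖ := by
  obtain ⟨M, hM, -, hle⟩ := exists_norm_kernelTerm_le w1 w2 g1 g2 hp hq hυ (x.1 + 1) (x.2 + 1)
  exact Summable.of_nonneg_of_le (fun _ => norm_nonneg _)
    (fun i => hle i x ⟨⟨h1, lt_add_one _⟩, h2, lt_add_one _⟩) (hM.mul_right _)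

theorem hasSum_kernelTerm (hp : 0 < p.re) (hq : 0 < q.re) (hυ : 0 < υ.re) {x : ℝ × ℝ}
    (h1 : 0 < x.1) (h2 : 0 < x.2) :
    HasSum (fun i => kernelTerm p q υ w1 w2 g1 g2 i x)
      (kernel p q υ w1 w2 (special g1 g2 g3) x) := by
  have hs := (summable_norm_kernelTerm w1 w2 g1 g2 hp hq hυ h1 h2).of_norm
  have : kernel p q υ w1 w2 (special g1 g2 g3) x =
      ∑' i, kernelTerm p q υ w1 w2 g1 g2 i x := by
    rw [hs.tsum_prod, kernel, mittagLeffler]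
    simp only [kernelTerm_eq p q υ w1 w2 g1 g2 g3 _ _ h1 h2, tsum_mul_left]
  rw [this]
  exact hs.hasSum

theorem measurable_kernelTerm (i : ℕ × ℕ) :
    Measurable (kernelTerm p q υ w1 w2 g1 g2 i) := by
  unfold kernelTerm
  fun_prop

theorem integrableOn_rpow_sub_one {a : ℝ} (ha : 0 < a) (B : ℝ) :
    IntegrableOn (fun x : ℝ => x ^ (a - 1)) (Ioo 0 B) := by
  rcases le_or_gt B 0 with hB | hB
  · simp [Ioo_eq_empty_of_le hB]
  · exact (intervalIntegral.integrableOn_Ioo_rpow_iff hB).mpr (by linarith)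

theorem integrableOn_kernel (hp : 0 < p.re) (hq : 0 < q.re) (hυ : 0 < υ.re) (B1 B2 : ℝ) :
    IntegrableOn (kernel p q υ w1 w2 (special g1 g2 g3)) (Ioo 0 B1 ×ˢ Ioo 0 B2) := by
  obtain ⟨M, hM, -, hle⟩ := exists_norm_kernelTerm_le w1 w2 g1 g2 hp hq hυ B1 B2
  have hmem := ae_restrict_mem (μ := (volume : Measure (ℝ × ℝ)))
    (measurableSet_Ioo (a := (0 : ℝ)) (b := B1) |>.prod (measurableSet_Ioo (a := (0 : ℝ)) (b := B2)))
  have hg : IntegrableOn (fun x : ℝ × ℝ => x.1 ^ (p.re - 1) * x.2 ^ (q.re - 1))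
      (Ioo 0 B1 ×ˢ Ioo 0 B2) := by
    rw [IntegrableOn, Measure.volume_eq_prod, ← Measure.prod_restrict]
    exact (integrableOn_rpow_sub_one hp B1).mul_prod (integrableOn_rpow_sub_one hq B2)
  refine Integrable.mono' (hg.const_mul (∑' i, M i)) ?_ ?_
  · refine aestronglyMeasurable_of_tendsto_ae (Filter.atTop : Filter (Finset (ℕ × ℕ)))
      (f := fun s x => ∑ i ∈ s, kernelTerm p q υ w1 w2 g1 g2 i x) (fun s => ?_) ?_
    · exact (Finset.measurable_fun_sum s fun i _ =>
        measurable_kernelTerm w1 w2 g1 g2 i).aestronglyMeasurable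
    · filter_upwards [hmem] with x hx
      exact hasSum_kernelTerm w1 w2 g1 g2 g3 hp hq hυ hx.1.1 hx.2.1
  · filter_upwards [hmem] with x hx
    rw [← (hasSum_kernelTerm w1 w2 g1 g2 g3 hp hq hυ hx.1.1 hx.2.1).tsum_eq]
    exact tsum_of_norm_bounded (hM.hasSum.mul_right _) fun i => hle i x hx

end Bounds

/-! ### Beta integrals and convolution of kernels -/

theorem setIntegral_Ioo_cpow_mul_cpow {s u : ℂ} (hs : 0 < s.re) (hu : 0 < u.re) {z : ℝ}
    (hz : 0 < z) :
    ∫ t in Ioo 0 z, ((z - t : ℝ) : ℂ) ^ (s - 1) * (t : ℂ) ^ (u - 1) =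
      (z : ℂ) ^ (s + u - 1) * (Complex.Gamma s * Complex.Gamma u / Complex.Gamma (s + u)) := by
  have h := Complex.betaIntegral_scaled u s hz
  rw [intervalIntegral.integral_of_le hz.le, integral_Ioc_eq_integral_Ioo] at h
  rw [mul_comm (Complex.Gamma s), add_comm s, Complex.Gamma_mul_Gamma_eq_betaIntegral hu hs,
    mul_div_cancel_left₀ _ (Complex.Gamma_ne_zero_of_re_pos (by simpa using add_pos hu hs)), ← h]
  refine setIntegral_congr_fun measurableSet_Ioo fun t _ => ?_
  simp only [Complex.ofReal_sub]
  exact mul_comm _ _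

theorem integrableOn_rpow_mul_rpow {a b : ℝ} (ha : 0 < a) (hb : 0 < b) {z : ℝ} (hz : 0 < z) :
    IntegrableOn (fun t : ℝ => (z - t) ^ (a - 1) * t ^ (b - 1)) (Ioo 0 z) := by
  have h := setIntegral_Ioo_cpow_mul_cpow (s := a) (u := b) (by simpa) (by simpa) hz
  have hi : IntegrableOn (fun t : ℝ => ((z - t : ℝ) : ℂ) ^ ((a : ℂ) - 1) *
      (t : ℂ) ^ ((b : ℂ) - 1)) (Ioo 0 z) := by
    -- The integral of a non-integrable function is `0` by default, whereas the Beta value is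
    -- nonzero.
    refine not_imp_comm.mp integral_undef ?_
    rw [h]
    have hz' : (z : ℂ) ≠ 0 := Complex.ofReal_ne_zero.mpr hz.ne'
    refine mul_ne_zero (by simp [Complex.cpow_eq_zero_iff, hz']) (div_ne_zero (mul_ne_zero ?_ ?_) ?_)
    all_goals exact Complex.Gamma_ne_zero_of_re_pos (by simp; positivity)
  refine IntegrableOn.congr_fun hi.norm (fun t ht => ?_) measurableSet_Ioo
  simp only [norm_mul]
  rw [Complex.norm_cpow_eq_rpow_re_of_pos (sub_pos.mpr ht.2),
    Complex.norm_cpow_eq_rpow_re_of_pos ht.1]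
  simp

theorem hasSum_mul_of_summable_norm {ι κ : Type*} {f : ι → ℂ} {g : κ → ℂ} {a b : ℂ}
    (hf : HasSum f a) (hg : HasSum g b) (hf' : Summable fun i => ‖f i‖)
    (hg' : Summable fun j => ‖g j‖) : HasSum (fun ij : ι × κ => f ij.1 * g ij.2) (a * b) :=
  hf.mul hg (summable_mul_of_summable_norm hf' hg')

section Convolution

variable {p q υ σ τ : ℂ} (w1 w2 g1 g2 g3 h1 h2 h3 : ℂ)

/-- The common part of all products of two summands with the same total degree. -/
def degreeTerm (p q υ w1 w2 : ℂ) (i : ℕ × ℕ) (x : ℝ × ℝ) : ℂ :=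
  w1 ^ i.1 * (w2 ^ υ) ^ i.2 *
    (((x.1 : ℂ) ^ (p + i.1 - 1) / Complex.Gamma (p + i.1)) *
      ((x.2 : ℂ) ^ (q + υ * i.2 - 1) / Complex.Gamma (q + υ * i.2)))

/-- The Beta integral in each variable adds exponents, so apart from the coefficients the result
depends on `i + j` alone. -/
theorem setIntegral_kernelTerm_mul_kernelTerm (hp : 0 < p.re) (hq : 0 < q.re) (hυ : 0 < υ.re)
    (hσ : 0 < σ.re) (hτ : 0 < τ.re) {x : ℝ × ℝ} (hx1 : 0 < x.1) (hx2 : 0 < x.2)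
    (i j : ℕ × ℕ) :
    ∫ t in Ioo 0 x.1 ×ˢ Ioo 0 x.2,
        kernelTerm p q υ w1 w2 g1 g2 i (x - t) * kernelTerm σ τ υ w1 w2 h1 h2 j t =
      coef g1 g2 i.1 i.2 * coef h1 h2 j.1 j.2 *
        degreeTerm (p + σ) (q + τ) υ w1 w2 (i + j) x := by
  have r1 {s : ℂ} (hs : 0 < s.re) (n : ℕ) : 0 < (s + n).re := by simp; positivity
  have r2 {s : ℂ} (hs : 0 < s.re) (n : ℕ) : 0 < (s + υ * n).re := by simp; positivity
  have k1 := setIntegral_Ioo_cpow_mul_cpow (r1 hp i.1) (r1 hσ j.1) hx1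
  have k2 := setIntegral_Ioo_cpow_mul_cpow (r2 hq i.2) (r2 hτ j.2) hx2
  have n1 := Complex.Gamma_ne_zero_of_re_pos (r1 hp i.1)
  have n2 := Complex.Gamma_ne_zero_of_re_pos (r1 hσ j.1)
  have n3 := Complex.Gamma_ne_zero_of_re_pos (r2 hq i.2)
  have n4 := Complex.Gamma_ne_zero_of_re_pos (r2 hτ j.2)
  have m1 : p + σ + ((i.1 + j.1 : ℕ) : ℂ) = p + i.1 + (σ + j.1) := by push_cast; ring
  have m2 : q + τ + υ * ((i.2 + j.2 : ℕ) : ℂ) = q + υ * i.2 + (τ + υ * j.2) := by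
    push_cast; ring
  have hint := setIntegral_prod_mul (μ := volume) (ν := volume)
    (fun t : ℝ => ((x.1 - t : ℝ) : ℂ) ^ (p + i.1 - 1) * (t : ℂ) ^ (σ + j.1 - 1))
    (fun t : ℝ => ((x.2 - t : ℝ) : ℂ) ^ (q + υ * i.2 - 1) * (t : ℂ) ^ (τ + υ * j.2 - 1))
    (Ioo 0 x.1) (Ioo 0 x.2)
  rw [k1, k2, ← Measure.volume_eq_prod] at hint
  set A := coef g1 g2 i.1 i.2 * coef h1 h2 j.1 j.2 * w1 ^ (i.1 + j.1) *
    (w2 ^ υ) ^ (i.2 + j.2) / (Complex.Gamma (p + i.1) * Complex.Gamma (q + υ * i.2) *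
      Complex.Gamma (σ + j.1) * Complex.Gamma (τ + υ * j.2)) with hA
  have hfun (t : ℝ × ℝ) :
      kernelTerm p q υ w1 w2 g1 g2 i (x - t) * kernelTerm σ τ υ w1 w2 h1 h2 j t =
      A * ((((x.1 - t.1 : ℝ) : ℂ) ^ (p + i.1 - 1) * (t.1 : ℂ) ^ (σ + j.1 - 1)) *
        (((x.2 - t.2 : ℝ) : ℂ) ^ (q + υ * i.2 - 1) * (t.2 : ℂ) ^ (τ + υ * j.2 - 1))) := by
    simp only [kernelTerm, hA, Prod.fst_sub, Prod.snd_sub, pow_add, div_eq_mul_inv, mul_inv]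
    ring
  simp only [hfun]
  rw [integral_const_mul, hint, degreeTerm, Prod.fst_add, Prod.snd_add, m1, m2, hA]
  field_simp

open Finset in
theorem hasSum_kernelTerm_of_hasSum_degreeTerm {p q : ℂ} {x : ℝ × ℝ} {S : ℂ}
    (h : HasSum (fun ij : (ℕ × ℕ) × ℕ × ℕ => coef g1 g2 ij.1.1 ij.1.2 *
      coef h1 h2 ij.2.1 ij.2.2 * degreeTerm p q υ w1 w2 (ij.1 + ij.2) x) S) :
    HasSum (fun i => kernelTerm p q υ w1 w2 (g1 + h1) (g2 + h2) i x) S := by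
  rw [← (Equiv.prodProdProdComm ℕ ℕ ℕ ℕ).hasSum_iff] at h
  -- Grouping by total bidegree: each fibre is a finite product of antidiagonals, on which the
  -- coefficients form a Cauchy product.
  have hf := h.tsum_fiberwise fun a : (ℕ × ℕ) × ℕ × ℕ => (a.1.1 + a.1.2, a.2.1 + a.2.2)
  refine (funext ?_ : (fun i => kernelTerm p q υ w1 w2 (g1 + h1) (g2 + h2) i x) = _) ▸ hf
  rintro ⟨L, M⟩
  have hfib : (fun a : (ℕ × ℕ) × ℕ × ℕ => (a.1.1 + a.1.2, a.2.1 + a.2.2)) ⁻¹' {(L, M)} =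
      ↑(antidiagonal L ×ˢ antidiagonal M) := by
    ext a
    simp
  rw [hfib, Finset.tsum_subtype' (antidiagonal L ×ˢ antidiagonal M), sum_product, kernelTerm,
    ← sum_antidiagonal_coef_mul_coef]
  simp only [sum_mul]
  refine sum_congr rfl fun a ha => sum_congr rfl fun b hb => ?_
  have ha := mem_antidiagonal.mp ha
  have hb := mem_antidiagonal.mp hb
  simp only [Function.comp_apply, Equiv.prodProdProdComm_apply, degreeTerm, Prod.mk_add_mk, ha, hb]
  ring

/-- The kernels with special parameter sets form a convolution semigroup. -/
theorem setIntegral_kernel_mul_kernel (hp : 0 < p.re) (hq : 0 < q.re) (hυ : 0 < υ.re)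
    (hσ : 0 < σ.re) (hτ : 0 < τ.re) {x : ℝ × ℝ} (hx1 : 0 < x.1) (hx2 : 0 < x.2) :
    ∫ t in Ioo 0 x.1 ×ˢ Ioo 0 x.2, kernel p q υ w1 w2 (special g1 g2 g3) (x - t) *
        kernel σ τ υ w1 w2 (special h1 h2 h3) t =
      kernel (p + σ) (q + τ) υ w1 w2 (special (g1 + h1) (g2 + h2) (g3 + h3)) x := by
  obtain ⟨M, hM, hM0, hMle⟩ := exists_norm_kernelTerm_le w1 w2 g1 g2 hp hq hυ x.1 x.2
  obtain ⟨N, hN, hN0, hNle⟩ := exists_norm_kernelTerm_le w1 w2 h1 h2 hσ hτ hυ x.1 x.2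
  have hMN := hM.mul_of_nonneg hN hM0 hN0
  have hmem := ae_restrict_mem (μ := (volume : Measure (ℝ × ℝ)))
    (measurableSet_Ioo (a := (0 : ℝ)) (b := x.1) |>.prod
      (measurableSet_Ioo (a := (0 : ℝ)) (b := x.2)))
  set g : ℝ × ℝ → ℝ := fun t => ((x.1 - t.1) ^ (p.re - 1) * t.1 ^ (σ.re - 1)) *
    ((x.2 - t.2) ^ (q.re - 1) * t.2 ^ (τ.re - 1)) with hg
  have hgi : IntegrableOn g (Ioo 0 x.1 ×ˢ Ioo 0 x.2) := by
    rw [IntegrableOn, Measure.volume_eq_prod, ← Measure.prod_restrict]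
    exact (integrableOn_rpow_mul_rpow hp hσ hx1).mul_prod (integrableOn_rpow_mul_rpow hq hτ hx2)
  -- Termwise integration; the majorant is `M i * N j` times a product of two real Beta integrands.
  have hsum := hasSum_integral_of_dominated_convergence
    (μ := (volume : Measure (ℝ × ℝ)).restrict (Ioo 0 x.1 ×ˢ Ioo 0 x.2))
    (F := fun (ij : (ℕ × ℕ) × ℕ × ℕ) t =>
      kernelTerm p q υ w1 w2 g1 g2 ij.1 (x - t) * kernelTerm σ τ υ w1 w2 h1 h2 ij.2 t)
    (f := fun t => kernel p q υ w1 w2 (special g1 g2 g3) (x - t) *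
        kernel σ τ υ w1 w2 (special h1 h2 h3) t)
    (fun ij t => M ij.1 * N ij.2 * g t) (fun ij => ?_) (fun ij => ?_) ?_ ?_ ?_
  · simp only [setIntegral_kernelTerm_mul_kernelTerm w1 w2 g1 g2 h1 h2 hp hq hυ hσ hτ hx1 hx2]
      at hsum
    have hpσ : 0 < (p + σ).re := by simpa using add_pos hp hσ
    have hqτ : 0 < (q + τ).re := by simpa using add_pos hq hτ
    exact (hasSum_kernelTerm_of_hasSum_degreeTerm w1 w2 g1 g2 h1 h2 hsum).unique
      (hasSum_kernelTerm w1 w2 _ _ _ hpσ hqτ hυ hx1 hx2)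
  · exact (((measurable_kernelTerm w1 w2 g1 g2 ij.1).comp (measurable_const.sub measurable_id)).mul
      (measurable_kernelTerm w1 w2 h1 h2 ij.2)).aestronglyMeasurable
  · filter_upwards [hmem] with t ht
    have hxt : x - t ∈ Ioo 0 x.1 ×ˢ Ioo 0 x.2 := by
      obtain ⟨⟨t1, t2⟩, t3, t4⟩ := ht
      refine ⟨⟨?_, ?_⟩, ?_, ?_⟩ <;> simp <;> assumption
    rw [norm_mul]
    refine (mul_le_mul (hMle ij.1 _ hxt) (hNle ij.2 _ ht) (norm_nonneg _)
      ((norm_nonneg _).trans (hMle ij.1 _ hxt))).trans_eq ?_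
    simp only [hg, Prod.fst_sub, Prod.snd_sub]
    ring
  · exact Filter.Eventually.of_forall fun t => hMN.mul_right _
  · simp only [tsum_mul_right]
    exact hgi.const_mul _
  · filter_upwards [hmem] with t ht
    have q1 : 0 < (x - t).1 := sub_pos.mpr ht.1.2
    have q2 : 0 < (x - t).2 := sub_pos.mpr ht.2.2
    have s1 := summable_norm_kernelTerm w1 w2 g1 g2 hp hq hυ q1 q2
    have s2 := summable_norm_kernelTerm w1 w2 h1 h2 hσ hτ hυ ht.1.1 ht.2.1
    have s3 := hasSum_mul_of_summable_norm (hasSum_kernelTerm w1 w2 g1 g2 g3 hp hq hυ q1 q2)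
      (hasSum_kernelTerm w1 w2 h1 h2 h3 hσ hτ hυ ht.1.1 ht.2.1) s1 s2
    exact s3

end Convolution

/-! ### Volterra operators as plane convolutions -/

/-- The two-dimensional Volterra operator with convolution kernel `K`. -/
def volterraOp (K : ℝ × ℝ → ℂ) (a1 a2 : ℝ) (d : ℝ × ℝ → ℂ) (X : ℝ × ℝ) : ℂ :=
  ∫ y in a2..X.2, ∫ ξ in a1..X.1, K (X - (ξ, y)) * d (ξ, y)

/-- Convolution of complex functions on the plane. -/
abbrev planeConv (f g : ℝ × ℝ → ℂ) : ℝ × ℝ → ℂ :=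
  convolution f g (ContinuousLinearMap.mul ℂ ℂ) volume

theorem integral_Ioo_prod_eq_intervalIntegral {f : ℝ × ℝ → ℂ} {a1 a2 : ℝ} {X : ℝ × ℝ}
    (h1 : a1 ≤ X.1) (h2 : a2 ≤ X.2) (hf : IntegrableOn f (Ioo a1 X.1 ×ˢ Ioo a2 X.2)) :
    ∫ x in Ioo a1 X.1 ×ˢ Ioo a2 X.2, f x = ∫ y in a2..X.2, ∫ ξ in a1..X.1, f (ξ, y) := by
  simp only [intervalIntegral.integral_of_le h1, intervalIntegral.integral_of_le h2,
    integral_Ioc_eq_integral_Ioo]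
  rw [IntegrableOn, Measure.volume_eq_prod, ← Measure.prod_restrict] at *
  exact integral_prod_symm _ hf

section Volterra

variable {a1 b1 a2 b2 : ℝ} {d K K1 K2 K3 : ℝ × ℝ → ℂ}

/-- For `X` in the box, the conditions `a < t < X` already imply `t < b` and `X - t < b - a`.
Truncating data and kernel to bounded boxes therefore loses nothing. -/
theorem planeConv_integrand_eq_indicator {X : ℝ × ℝ} (hX : X ∈ Ioo a1 b1 ×ˢ Ioo a2 b2)
    (d K : ℝ × ℝ → ℂ) (t : ℝ × ℝ) :
    (Ioo a1 b1 ×ˢ Ioo a2 b2).indicator d t *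
        (Ioo 0 (b1 - a1) ×ˢ Ioo 0 (b2 - a2)).indicator K (X - t) =
      (Ioo a1 X.1 ×ˢ Ioo a2 X.2).indicator (fun x => K (X - x) * d x) t := by
  obtain ⟨⟨h1, h2⟩, h3, h4⟩ := hX
  by_cases ht : t ∈ Ioo a1 X.1 ×ˢ Ioo a2 X.2
  · obtain ⟨⟨g1, g2⟩, g3, g4⟩ := id ht
    rw [indicator_of_mem ht, indicator_of_mem, indicator_of_mem, mul_comm]
    · refine ⟨⟨?_, ?_⟩, ?_, ?_⟩ <;> simp only [Prod.fst_sub, Prod.snd_sub] <;> linarith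
    · exact ⟨⟨g1, g2.trans h2⟩, g3, g4.trans h4⟩
  · rw [indicator_of_notMem ht]
    by_contra hne
    obtain ⟨n1, n2⟩ := mul_ne_zero_iff.mp hne
    obtain ⟨⟨g1, -⟩, g3, -⟩ := mem_of_indicator_ne_zero n1
    obtain ⟨⟨k1, -⟩, k3, -⟩ := mem_of_indicator_ne_zero n2
    simp only [Prod.fst_sub, Prod.snd_sub] at k1 k3
    exact ht ⟨⟨g1, by linarith⟩, g3, by linarith⟩

theorem measurableSet_Ioo_prod_Ioo (u1 v1 u2 v2 : ℝ) :
    MeasurableSet (Ioo u1 v1 ×ˢ Ioo u2 v2) := measurableSet_Ioo.prod measurableSet_Ioo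

/-- The a.e. existence of `L¹` convolutions gives the absolute convergence, and Fubini then
identifies the iterated integral. -/
theorem ae_volterraOp_eq_planeConv (hd : IntegrableOn d (Ioo a1 b1 ×ˢ Ioo a2 b2))
    (hK : IntegrableOn K (Ioo 0 (b1 - a1) ×ˢ Ioo 0 (b2 - a2))) :
    ∀ᵐ X ∂(volume.restrict (Ioo a1 b1 ×ˢ Ioo a2 b2)),
      IntegrableOn (fun x => K (X - x) * d x) (Ioo a1 X.1 ×ˢ Ioo a2 X.2) ∧
      volterraOp K a1 a2 d X = planeConv ((Ioo a1 b1 ×ˢ Ioo a2 b2).indicator d)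
        ((Ioo 0 (b1 - a1) ×ˢ Ioo 0 (b2 - a2)).indicator K) X := by
  have hd' := (integrable_indicator_iff (measurableSet_Ioo_prod_Ioo _ _ _ _)).mpr hd
  have hK' := (integrable_indicator_iff (measurableSet_Ioo_prod_Ioo _ _ _ _)).mpr hK
  filter_upwards [ae_restrict_of_ae
      (hd'.ae_convolution_exists (ContinuousLinearMap.mul ℂ ℂ) hK'),
    ae_restrict_mem (measurableSet_Ioo_prod_Ioo _ _ _ _)] with X hX hXm
  have hi : IntegrableOn (fun x => K (X - x) * d x) (Ioo a1 X.1 ×ˢ Ioo a2 X.2) := by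
    rw [← integrable_indicator_iff (measurableSet_Ioo_prod_Ioo _ _ _ _)]
    refine hX.integrable.congr (Filter.Eventually.of_forall fun t => ?_)
    exact planeConv_integrand_eq_indicator hXm d K t
  refine ⟨hi, ?_⟩
  rw [volterraOp, ← integral_Ioo_prod_eq_intervalIntegral hXm.1.1.le hXm.2.1.le hi,
    planeConv, convolution_def, ← integral_indicator (measurableSet_Ioo_prod_Ioo _ _ _ _)]
  exact integral_congr_ae (Filter.Eventually.of_forall fun t =>
    (planeConv_integrand_eq_indicator hXm d K t).symm)

theorem integrableOn_volterraOp (hd : IntegrableOn d (Ioo a1 b1 ×ˢ Ioo a2 b2))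
    (hK : IntegrableOn K (Ioo 0 (b1 - a1) ×ˢ Ioo 0 (b2 - a2))) :
    IntegrableOn (volterraOp K a1 a2 d) (Ioo a1 b1 ×ˢ Ioo a2 b2) := by
  have hd' := (integrable_indicator_iff (measurableSet_Ioo_prod_Ioo _ _ _ _)).mpr hd
  have hK' := (integrable_indicator_iff (measurableSet_Ioo_prod_Ioo _ _ _ _)).mpr hK
  refine (hd'.integrable_convolution (ContinuousLinearMap.mul ℂ ℂ) hK').integrableOn.congr ?_
  filter_upwards [ae_volterraOp_eq_planeConv hd hK] with X hX
  exact hX.2.symm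

/-- A convolution of functions supported in the quadrants with vertices `a` and `0` is supported
in the quadrant with vertex `a`. -/
theorem planeConv_ne_zero {f g : ℝ × ℝ → ℂ} {a : ℝ × ℝ}
    (hf : ∀ x, f x ≠ 0 → a.1 < x.1 ∧ a.2 < x.2) (hg : ∀ x, g x ≠ 0 → 0 < x.1 ∧ 0 < x.2)
    {t : ℝ × ℝ} (ht : planeConv f g t ≠ 0) : a.1 < t.1 ∧ a.2 < t.2 := by
  by_contra hcon
  refine ht ?_
  rw [planeConv, convolution_def]
  refine integral_eq_zero_of_ae (Filter.Eventually.of_forall fun s => ?_)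
  by_contra hne
  obtain ⟨n1, n2⟩ := mul_ne_zero_iff.mp hne
  have h1 := hf _ n1
  have h2 := hg _ n2
  simp only [Prod.fst_sub, Prod.snd_sub, sub_pos] at h2
  exact hcon ⟨h1.1.trans h2.1, h1.2.trans h2.2⟩

theorem indicator_Ioo_prod_Ioo_ne_zero {f : ℝ × ℝ → ℂ} {u1 v1 u2 v2 : ℝ} (x : ℝ × ℝ)
    (h : (Ioo u1 v1 ×ˢ Ioo u2 v2).indicator f x ≠ 0) : u1 < x.1 ∧ u2 < x.2 :=
  have hx := mem_of_indicator_ne_zero h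
  ⟨hx.1.1, hx.2.1⟩

/-- Convolving the norms shows that the triple integral converges absolutely at almost every point,
where Fubini applies. -/
theorem planeConv_assoc_ae {f g k : ℝ × ℝ → ℂ} (hf : Integrable f) (hg : Integrable g)
    (hk : Integrable k) :
    ∀ᵐ X, planeConv (planeConv f g) k X = planeConv f (planeConv g k) X := by
  have hgk := hg.norm.integrable_convolution (ContinuousLinearMap.mul ℝ ℝ) hk.norm
  filter_upwards [hf.norm.ae_convolution_exists (ContinuousLinearMap.mul ℝ ℝ) hgk] with X hX
  exact convolution_assoc _ _ _ _ (fun x y z => mul_assoc x y z) hf.1 hg.1 hk.1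
    (hf.ae_convolution_exists _ hg) (hg.norm.ae_convolution_exists _ hk.norm) hX

/-- Two Volterra operators compose by convolving their kernels. -/
theorem ae_volterraOp_volterraOp (hd : IntegrableOn d (Ioo a1 b1 ×ˢ Ioo a2 b2))
    (hK1 : IntegrableOn K1 (Ioo 0 (b1 - a1) ×ˢ Ioo 0 (b2 - a2)))
    (hK2 : IntegrableOn K2 (Ioo 0 (b1 - a1) ×ˢ Ioo 0 (b2 - a2)))
    (hK3 : IntegrableOn K3 (Ioo 0 (b1 - a1) ×ˢ Ioo 0 (b2 - a2)))
    (h : ∀ x ∈ Ioo 0 (b1 - a1) ×ˢ Ioo 0 (b2 - a2),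
      ∫ t in Ioo 0 x.1 ×ˢ Ioo 0 x.2, K1 (x - t) * K2 t = K3 x) :
    ∀ᵐ X ∂(volume.restrict (Ioo a1 b1 ×ˢ Ioo a2 b2)),
      volterraOp K1 a1 a2 (volterraOp K2 a1 a2 d) X = volterraOp K3 a1 a2 d X := by
  set S := Ioo a1 b1 ×ˢ Ioo a2 b2 with hS
  set Q := Ioo 0 (b1 - a1) ×ˢ Ioo 0 (b2 - a2) with hQ
  have hSm : MeasurableSet S := measurableSet_Ioo_prod_Ioo _ _ _ _
  have hQm : MeasurableSet Q := measurableSet_Ioo_prod_Ioo _ _ _ _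
  have hassoc := planeConv_assoc_ae ((integrable_indicator_iff hSm).mpr hd)
    ((integrable_indicator_iff hQm).mpr hK2) ((integrable_indicator_iff hQm).mpr hK1)
  have hinner := ae_volterraOp_eq_planeConv hd hK2
  rw [ae_restrict_iff' hSm] at hinner
  filter_upwards [ae_volterraOp_eq_planeConv (integrableOn_volterraOp hd hK2) hK1,
    ae_volterraOp_eq_planeConv hd hK3, ae_restrict_of_ae hassoc, ae_restrict_mem hSm]
    with X hX1 hX3 hXa hXm
  rw [hX1.2, hX3.2]
  trans planeConv (planeConv (S.indicator d) (Q.indicator K2)) (Q.indicator K1) X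
  · refine integral_congr_ae ?_
    filter_upwards [hinner] with t ht
    simp only [ContinuousLinearMap.mul_apply']
    by_cases hK : Q.indicator K1 (X - t) = 0
    · rw [hK, mul_zero, mul_zero]
    congr 1
    by_cases htS : t ∈ S
    · rw [indicator_of_mem htS]
      exact (ht htS).2
    -- The full convolution may be nonzero beyond the upper ends of `S`, but the outer kernel sees
    -- only `t < X`. Inside that range, a nonzero value would force `t ∈ S`.
    rw [indicator_of_notMem htS]
    symm
    by_contra hne
    have h1 := planeConv_ne_zero (a := (a1, a2)) indicator_Ioo_prod_Ioo_ne_zero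
      indicator_Ioo_prod_Ioo_ne_zero hne
    have h2 := indicator_Ioo_prod_Ioo_ne_zero _ hK
    simp only [Prod.fst_sub, Prod.snd_sub, sub_pos] at h2
    exact htS ⟨⟨h1.1, h2.1.trans hXm.1.2⟩, h1.2, h2.2.trans hXm.2.2⟩
  rw [hXa]
  refine integral_congr_ae (Filter.Eventually.of_forall fun s => ?_)
  simp only [ContinuousLinearMap.mul_apply']
  by_cases hsS : s ∈ S
  swap
  · rw [indicator_of_notMem hsS, zero_mul, zero_mul]
  congr 1
  by_cases hsQ : X - s ∈ Q
  · rw [indicator_of_mem hsQ, ← h _ hsQ, planeConv, convolution_def,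
      ← integral_indicator (measurableSet_Ioo_prod_Ioo _ _ _ _)]
    refine integral_congr_ae (Filter.Eventually.of_forall fun t => ?_)
    have := planeConv_integrand_eq_indicator (a1 := 0) (a2 := 0) (b1 := b1 - a1)
      (b2 := b2 - a2) (X := X - s) hsQ K2 K1 t
    simp only [sub_zero] at this
    exact this
  -- Since `X` and `s` lie in `S`, the upper bounds of `Q` hold for `X - s`; a nonzero convolution
  -- would supply the lower ones.
  · rw [indicator_of_notMem hsQ]
    by_contra hne
    have h1 := planeConv_ne_zero (a := (0, 0)) indicator_Ioo_prod_Ioo_ne_zero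
      indicator_Ioo_prod_Ioo_ne_zero hne
    refine hsQ ⟨⟨h1.1, ?_⟩, h1.2, ?_⟩
    · have := hXm.1.2
      have := hsS.1.1
      simp only [Prod.fst_sub]
      linarith
    · have := hXm.2.2
      have := hsS.2.1
      simp only [Prod.snd_sub]
      linarith

end Volterra

/-! ### Zero parameters and the Riemann-Liouville integral -/

theorem poch_zero_left {n : ℕ} (hn : n ≠ 0) : poch 0 n = 0 :=
  ascPochhammer_ne_zero_eval_zero ℂ hn

theorem coef_zero_zero {l m : ℕ} (h : l ≠ 0 ∨ m ≠ 0) : coef 0 0 l m = 0 := by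
  by_cases hl : l = 0
  · subst hl
    simp [coef, poch_zero_left (h.resolve_left fun h => h rfl)]
  · simp [coef, poch_zero_left hl]

/-- The cancelled reading matters here, as the denominators `(0)_l` vanish for `l ≥ 1`. These terms
die through `(γ₁/2)_l = 0`, and those with `l = 0 < m` through `(γ₂)_m = 0`. -/
theorem mittagLeffler_special_zero (p q υ z t : ℂ) :
    mittagLeffler p q υ (special 0 0 0) z t = 1 / (Complex.Gamma p * Complex.Gamma q) := by
  rw [mittagLeffler, tsum_eq_single 0 fun l hl => ?_, tsum_eq_single 0 fun m hm => ?_]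
  · simp [mlTerm_special, coef, poch]
  · simp [mlTerm_special, coef_zero_zero (Or.inr hm)]
  · simp [mlTerm_special, coef_zero_zero (Or.inl hl)]

theorem opIntegrand_special_zero (p q υ w1 w2 : ℂ) (d : ℝ × ℝ → ℂ) (X x : ℝ × ℝ) :
    opIntegrand p q υ w1 w2 (special 0 0 0) d X x =
      1 / (Complex.Gamma p * Complex.Gamma q) * rlIntegrand p q d X x := by
  rw [opIntegrand, rlIntegrand, mittagLeffler_special_zero]
  ring

theorem frakE_special_zero (p q υ w1 w2 : ℂ) (a1 a2 : ℝ) (d : ℝ × ℝ → ℂ) (X : ℝ × ℝ) :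
    frakE p q υ w1 w2 a1 a2 (special 0 0 0) d X = rlDouble p q a1 a2 d X := by
  simp only [frakE, rlDouble, opIntegrand_special_zero, intervalIntegral.integral_const_mul]

theorem RLDoubleConverges.of_frakEConverges {p q υ w1 w2 : ℂ} (hp : 0 < p.re) (hq : 0 < q.re)
    {a1 a2 : ℝ} {d : ℝ × ℝ → ℂ} {X : ℝ × ℝ}
    (h : FrakEConverges p q υ w1 w2 a1 a2 (special 0 0 0) d X) :
    RLDoubleConverges p q a1 a2 d X := by
  have hne : Complex.Gamma p * Complex.Gamma q ≠ 0 :=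
    mul_ne_zero (Complex.Gamma_ne_zero_of_re_pos hp) (Complex.Gamma_ne_zero_of_re_pos hq)
  have h' := Integrable.const_mul h (Complex.Gamma p * Complex.Gamma q)
  simp only [opIntegrand_special_zero, ← mul_assoc, mul_one_div_cancel hne, one_mul] at h'
  exact h'

/-! ### The semigroup law and the theorem -/

/-- The semigroup property, for arbitrary complex parameters. -/
theorem frakE_frakE_special {p q υ σ τ : ℂ} (w1 w2 g1 g2 g3 h1 h2 h3 : ℂ)
    (hp : 0 < p.re) (hq : 0 < q.re) (hυ : 0 < υ.re) (hσ : 0 < σ.re) (hτ : 0 < τ.re)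
    {a1 b1 a2 b2 : ℝ} {d : ℝ × ℝ → ℂ} (hd : IntegrableOn d (Ioo a1 b1 ×ˢ Ioo a2 b2)) :
    IntegrableOn (frakE σ τ υ w1 w2 a1 a2 (special h1 h2 h3) d) (Ioo a1 b1 ×ˢ Ioo a2 b2) ∧
    ∀ᵐ X ∂(volume.restrict (Ioo a1 b1 ×ˢ Ioo a2 b2)),
      FrakEConverges σ τ υ w1 w2 a1 a2 (special h1 h2 h3) d X ∧
      FrakEConverges p q υ w1 w2 a1 a2 (special g1 g2 g3)
        (frakE σ τ υ w1 w2 a1 a2 (special h1 h2 h3) d) X ∧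
      FrakEConverges (p + σ) (q + τ) υ w1 w2 a1 a2
        (special (g1 + h1) (g2 + h2) (g3 + h3)) d X ∧
      frakE p q υ w1 w2 a1 a2 (special g1 g2 g3)
          (frakE σ τ υ w1 w2 a1 a2 (special h1 h2 h3) d) X =
        frakE (p + σ) (q + τ) υ w1 w2 a1 a2 (special (g1 + h1) (g2 + h2) (g3 + h3)) d X := by
  have hpσ : 0 < (p + σ).re := by simpa using add_pos hp hσ
  have hqτ : 0 < (q + τ).re := by simpa using add_pos hq hτ
  have hK1 := integrableOn_kernel w1 w2 g1 g2 g3 hp hq hυ (b1 - a1) (b2 - a2)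
  have hK2 := integrableOn_kernel w1 w2 h1 h2 h3 hσ hτ hυ (b1 - a1) (b2 - a2)
  have hK3 := integrableOn_kernel w1 w2 (g1 + h1) (g2 + h2) (g3 + h3) hpσ hqτ hυ
    (b1 - a1) (b2 - a2)
  have hint := integrableOn_volterraOp hd hK2
  refine ⟨hint, ?_⟩
  filter_upwards [ae_volterraOp_eq_planeConv hd hK2, ae_volterraOp_eq_planeConv hint hK1,
    ae_volterraOp_eq_planeConv hd hK3, ae_volterraOp_volterraOp hd hK1 hK2 hK3 fun x hx =>
      setIntegral_kernel_mul_kernel w1 w2 g1 g2 g3 h1 h2 h3 hp hq hυ hσ hτ hx.1.1 hx.2.1]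
    with X c2 c1 c3 heq
  exact ⟨c2.1, c1.1, c3.1, heq⟩

end KonhauserML

end

theorem mainTheorem11 (p q υ σ τ w1 w2 γ1 γ2 γ3 : ℂ)
    (hp : 0 < p.re) (hq : 0 < q.re) (hυ : 0 < υ.re) (hσ : 0 < σ.re) (hτ : 0 < τ.re)
    (hγ1 : 0 < γ1.re) (hγ2 : 0 < γ2.re) (hγ3 : 0 < γ3.re)
    (a1 b1 a2 b2 : ℝ) (d : ℝ × ℝ → ℂ)
    (hd : MeasureTheory.IntegrableOn d (Set.Ioo a1 b1 ×ˢ Set.Ioo a2 b2)) :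
    (∀ μ1 μ2 μ3 : ℂ, 0 < μ1.re → 0 < μ2.re → 0 < μ3.re →
      MeasureTheory.IntegrableOn
        (KonhauserML.frakE σ τ υ w1 w2 a1 a2 (KonhauserML.special μ1 μ2 μ3) d)
        (Set.Ioo a1 b1 ×ˢ Set.Ioo a2 b2) ∧
      ∀ᵐ X ∂(MeasureTheory.volume.restrict (Set.Ioo a1 b1 ×ˢ Set.Ioo a2 b2)),
        KonhauserML.FrakEConverges σ τ υ w1 w2 a1 a2 (KonhauserML.special μ1 μ2 μ3) d X ∧
        KonhauserML.FrakEConverges p q υ w1 w2 a1 a2 (KonhauserML.special γ1 γ2 γ3)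
          (KonhauserML.frakE σ τ υ w1 w2 a1 a2 (KonhauserML.special μ1 μ2 μ3) d) X ∧
        KonhauserML.FrakEConverges (p + σ) (q + τ) υ w1 w2 a1 a2
          (KonhauserML.special (γ1 + μ1) (γ2 + μ2) (γ3 + μ3)) d X ∧
        KonhauserML.frakE p q υ w1 w2 a1 a2 (KonhauserML.special γ1 γ2 γ3)
            (KonhauserML.frakE σ τ υ w1 w2 a1 a2 (KonhauserML.special μ1 μ2 μ3) d) X =
          KonhauserML.frakE (p + σ) (q + τ) υ w1 w2 a1 a2
            (KonhauserML.special (γ1 + μ1) (γ2 + μ2) (γ3 + μ3)) d X) ∧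
    (MeasureTheory.IntegrableOn
        (KonhauserML.frakE σ τ υ w1 w2 a1 a2 (KonhauserML.special (-γ1) (-γ2) (-γ3)) d)
        (Set.Ioo a1 b1 ×ˢ Set.Ioo a2 b2) ∧
      ∀ᵐ X ∂(MeasureTheory.volume.restrict (Set.Ioo a1 b1 ×ˢ Set.Ioo a2 b2)),
        KonhauserML.FrakEConverges σ τ υ w1 w2 a1 a2
          (KonhauserML.special (-γ1) (-γ2) (-γ3)) d X ∧
        KonhauserML.FrakEConverges p q υ w1 w2 a1 a2 (KonhauserML.special γ1 γ2 γ3)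
          (KonhauserML.frakE σ τ υ w1 w2 a1 a2 (KonhauserML.special (-γ1) (-γ2) (-γ3)) d) X ∧
        KonhauserML.RLDoubleConverges (p + σ) (q + τ) a1 a2 d X ∧
        KonhauserML.frakE p q υ w1 w2 a1 a2 (KonhauserML.special γ1 γ2 γ3)
            (KonhauserML.frakE σ τ υ w1 w2 a1 a2
              (KonhauserML.special (-γ1) (-γ2) (-γ3)) d) X =
          KonhauserML.rlDouble (p + σ) (q + τ) a1 a2 d X) := by
  refine ⟨fun μ1 μ2 μ3 _ _ _ =>
    KonhauserML.frakE_frakE_special w1 w2 γ1 γ2 γ3 μ1 μ2 μ3 hp hq hυ hσ hτ hd, ?_⟩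
  -- The inverse parameters make the composite parameter set `special 0 0 0`, whose operator is
  -- `rlDouble`.
  have h := KonhauserML.frakE_frakE_special w1 w2 γ1 γ2 γ3 (-γ1) (-γ2) (-γ3) hp hq hυ hσ hτ hd
  simp only [add_neg_cancel, KonhauserML.frakE_special_zero] at h
  refine ⟨h.1, h.2.mono fun X hX => ⟨hX.1, hX.2.1, ?_, hX.2.2.2⟩⟩
  exact KonhauserML.RLDoubleConverges.of_frakEConverges (by simpa using add_pos hp hσ)
    (by simpa using add_pos hq hτ) hX.2.2.1
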